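/- Let $\mathscr V$ be a braided monoidal additive category, with tensor product $\otimes$, tensor unit $I$ and braiding $c_{X,Y}\colon X\otimes Y\to Y\otimes X$. Here "additive" means that every hom set is an abelian group, and that composition and tensoring are additive in each variable. Assume that idempotents split in $\mathscr V$ and that multiplication by $2$ is invertible on every hom group $\mathscr V(X,Y)$. A composition algebra in $\mathscr V$ is an object $A$ equipped with a self-duality $A\dashv A$, with counit $\varepsilon\colon A\otimes A\to I$ and unit $\eta\colon I\to A\otimes A$ satisfying the two snake equations, which is symmetric ($\varepsilon\, c_{A,A}=\varepsilon$), together with morphisms $m\colon A\otimes A\to A$ and $e\colon I\to A$ such that (suppressing associativity and unit isomorphisms) $$\varepsilon(e\otimes e)=1_I,\qquad m\,c_{A,A}\,c_{A,A}=m,\qquad m(e\otimes 1_A)=1_A=m(1_A\otimes e),$$ $$\varepsilon(m\otimes m)(1_A\otimes c_{A,A}\otimes 1_A)+\varepsilon(m\otimes m)(1_A\otimes c_{A\otimes A,A})=2\,(\varepsilon\otimes\varepsilon).$$ The dimension of $A$ is the element $d_A=\varepsilon\, c_{A,A}\,\eta$ of the commutative ring $\mathscr V(I,I)$ (which equals $\varepsilon\,\eta$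 by symmetry). Then every composition algebra $A$ in $\mathscr V$ satisfies $$(d_A-1)(d_A-2)(d_A-4)(d_A-8)=0$$ in $\mathscr V(I,I)$. -/

import Mathlib

open CategoryTheory MonoidalCategory

universe v u

namespace BraidedComposition

section

variable {C : Type u} [Category.{v} C] [MonoidalCategory C] [BraidedCategory C]

/-- The dimension of an object `X` with dual `Y` in a braided monoidal category: the endomorphism
`I ⟶ X ⊗ Y ⟶ Y ⊗ X ⟶ I` of the tensor unit given by the unit of the duality, the braiding
and the counit of the duality. -/
def dimension (X Y : C) [ExactPairing X Y] : End (𝟙_ C) :=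
  η_ X Y ≫ (β_ X Y).hom ≫ ε_ X Y

variable [Preadditive C]

/-- A composition algebra structure on an object `A` of a braided monoidal additive category.

Writing the counit of the self-duality as a dot product, the axioms are the diagrammatic forms of
`a ⬝ b = b ⬝ a`, `e ⬝ e = 1`, `m ∘ c ∘ c = m`, `e a = a = a e` and
`(a c) ⬝ (b d) + (a d) ⬝ (b c) = 2 (a ⬝ b) (c ⬝ d)`. -/
structure CompositionAlgebra (A : C) where
  /-- the self-duality, with counit `ε_ A A : A ⊗ A ⟶ 𝟙_ C` and unit `η_ A A : 𝟙_ C ⟶ A ⊗ A` -/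
  dual : ExactPairing A A
  /-- the multiplication -/
  m : A ⊗ A ⟶ A
  /-- the identity -/
  e : 𝟙_ C ⟶ A
  /-- the self-duality is symmetric -/
  symm : (β_ A A).hom ≫ ε_ A A = ε_ A A
  /-- `e` is a unit vector -/
  norm_e : (λ_ (𝟙_ C)).inv ≫ (e ⊗ₘ e) ≫ ε_ A A = 𝟙 (𝟙_ C)
  /-- the multiplication does not see the double braiding -/
  braid_braid_m : (β_ A A).hom ≫ (β_ A A).hom ≫ m = m
  e_m : (λ_ A).inv ≫ (e ▷ A) ≫ m = 𝟙 A
  m_e : (ρ_ A).inv ≫ (A ◁ e) ≫ m = 𝟙 A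
  /-- The (polarized) multiplicativity of the norm. In the first term the second input string
  crosses over the third one; in the second term the second and the third input strings cross over
  the fourth one. -/
  norm_m :
    (α_ A A (A ⊗ A)).hom ≫ A ◁ (α_ A A A).inv ≫ A ◁ (β_ A A).hom ▷ A ≫
        A ◁ (α_ A A A).hom ≫ (α_ A A (A ⊗ A)).inv ≫ (m ⊗ₘ m) ≫ ε_ A A
      + (α_ A A (A ⊗ A)).hom ≫ A ◁ (α_ A A A).inv ≫ A ◁ (β_ (A ⊗ A) A).hom ≫
        (α_ A A (A ⊗ A)).inv ≫ (m ⊗ₘ m) ≫ ε_ A A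
      = (2 : ℕ) • ((ε_ A A ⊗ₘ ε_ A A) ≫ (λ_ (𝟙_ C)).hom)

/-- The dimension `d_A` of (the underlying object of) a composition algebra. -/
def CompositionAlgebra.dim {A : C} (S : CompositionAlgebra A) : End (𝟙_ C) :=
  letI := S.dual
  dimension A A

end

end BraidedComposition

/-! The idempotent `𝟙 A - S.tr ≫ S.e` splits off the imaginary part V, the orthogonal complement of
e. The imaginary part of the product is an antisymmetric × on V with a × b ⬝ c = a ⬝ b × c, and
multiplicativity of the norm becomes the norm identity in `CrossProduct`. The loop of V is n = d_A -
1 (`cupV_capV`), so the claim reduces to n(n-1)(n-3)(n-7) = 0.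

For V, the norm identity and the braid relations give (a×b)⬝(c×d) + a⬝((b×c)×d) in terms of ⬝ alone
(`g_add_h`). Rotating this equation forces the braiding on V to be an involution (`ibr_eq`). On V ⊗
V it reads H = 2B - U - 1 - K, with B the braiding, U cap-then-cup, K product-then-coproduct and H
the horizontal rung. A partial trace gives coproduct-then-product = 1 - n (`N_mul`).

The ladder H² is a square, hence invariant under a quarter turn, which exchanges 1 with U and K with
H and fixes B. Comparing H² with its rotation yields (7 - n)(1 + K - B) = 0; closing this up into a
scalar gives the relation. -/

namespace BraidedComposition

/-! ### Vector product algebras: the braiding is an involution -/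

section CrossProduct

variable {C : Type u} [Category.{v} C] [Preadditive C]

/-- A vector product algebra, presented by the endofunctor `T = V ⊗ -`. Every structure morphism
acts on the leftmost tensor factors, with an arbitrary object `W` to their right; naturality in `W`
is the interchange law. -/
structure CrossProduct (T : C ⥤ C) where
  br : ∀ W, T.obj (T.obj W) ⟶ T.obj (T.obj W)
  ibr : ∀ W, T.obj (T.obj W) ⟶ T.obj (T.obj W)
  cap : ∀ W, T.obj (T.obj W) ⟶ W
  cup : ∀ W, W ⟶ T.obj (T.obj W)
  mul : ∀ W, T.obj (T.obj W) ⟶ T.obj W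
  br_ibr : ∀ W, br W ≫ ibr W = 𝟙 _
  ibr_br : ∀ W, ibr W ≫ br W = 𝟙 _
  br_nat : ∀ {W W'} (f : W ⟶ W'), T.map (T.map f) ≫ br W' = br W ≫ T.map (T.map f)
  cap_nat : ∀ {W W'} (f : W ⟶ W'), T.map (T.map f) ≫ cap W' = cap W ≫ f
  cup_nat : ∀ {W W'} (f : W ⟶ W'), f ≫ cup W' = cup W ≫ T.map (T.map f)
  mul_nat : ∀ {W W'} (f : W ⟶ W'), T.map (T.map f) ≫ mul W' = mul W ≫ T.map f
  br_cap : ∀ W, br W ≫ cap W = cap W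
  cup_map_cap : ∀ W, cup (T.obj W) ≫ T.map (cap W) = 𝟙 _
  map_cup_cap : ∀ W, T.map (cup W) ≫ cap (T.obj W) = 𝟙 _
  br_mul : ∀ W, br W ≫ mul W = - mul W
  map_mul_cap : ∀ W, T.map (mul W) ≫ cap W = mul (T.obj W) ≫ cap W
  yang_baxter : ∀ W, br (T.obj W) ≫ T.map (br W) ≫ br (T.obj W) =
    T.map (br W) ≫ br (T.obj W) ≫ T.map (br W)
  br_map_br_cap : ∀ W, br (T.obj W) ≫ T.map (br W) ≫ cap (T.obj W) = T.map (cap W)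
  map_br_br_cap : ∀ W, T.map (br W) ≫ br (T.obj W) ≫ T.map (cap W) = cap (T.obj W)
  cup_map_br_br : ∀ W, cup (T.obj W) ≫ T.map (br W) ≫ br (T.obj W) = T.map (cup W)
  br_map_br_mul : ∀ W, br (T.obj W) ≫ T.map (br W) ≫ mul (T.obj W) = T.map (mul W) ≫ br W
  map_br_br_mul : ∀ W, T.map (br W) ≫ br (T.obj W) ≫ T.map (mul W) = mul (T.obj W) ≫ br W
  /-- the polarized norm identity `(a × c) ⬝ (b × d) + (a × d) ⬝ (b × c) = …` -/
  norm : ∀ W,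
    T.map (br (T.obj W)) ≫ mul (T.obj (T.obj W)) ≫ T.map (mul W) ≫ cap W
    + T.map (T.map (br W)) ≫ T.map (br (T.obj W)) ≫ mul (T.obj (T.obj W)) ≫ T.map (mul W) ≫ cap W
    = (2 : ℕ) • (cap (T.obj (T.obj W)) ≫ cap W)
      - T.map (br (T.obj W)) ≫ cap (T.obj (T.obj W)) ≫ cap W
      - T.map (T.map (br W)) ≫ T.map (br (T.obj W)) ≫ cap (T.obj (T.obj W)) ≫ cap W

namespace CrossProduct

variable {T : C ⥤ C} (D : CrossProduct T)

/-! ### Forms in four variables -/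

/-- `(a × b) ⬝ (c × d)` -/
def g (W : C) : T.obj (T.obj (T.obj (T.obj W))) ⟶ W :=
  D.mul (T.obj (T.obj W)) ≫ T.map (D.mul W) ≫ D.cap W

/-- `a ⬝ ((b × c) × d)` -/
def h (W : C) : T.obj (T.obj (T.obj (T.obj W))) ⟶ W :=
  T.map (D.mul (T.obj W)) ≫ T.map (D.mul W) ≫ D.cap W

/-- `(a ⬝ b) (c ⬝ d)` -/
def E (W : C) : T.obj (T.obj (T.obj (T.obj W))) ⟶ W :=
  D.cap (T.obj (T.obj W)) ≫ D.cap W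

/-- `(a ⬝ d) (b ⬝ c)` -/
def E' (W : C) : T.obj (T.obj (T.obj (T.obj W))) ⟶ W :=
  T.map (D.cap (T.obj W)) ≫ D.cap W

instance (W : C) : IsIso (D.br W) := ⟨D.ibr W, D.br_ibr W, D.ibr_br W⟩

abbrev s₁ (W : C) := D.br (T.obj (T.obj W))
abbrev s₂ (W : C) := T.map (D.br (T.obj W))
abbrev s₃ (W : C) := T.map (T.map (D.br W))
abbrev is₂ (W : C) := T.map (D.ibr (T.obj W))
abbrev is₃ (W : C) := T.map (T.map (D.ibr W))

lemma map_br_mul [T.Additive] (W : C) :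
    T.map (D.br W) ≫ T.map (D.mul W) = - T.map (D.mul W) := by
  rw [← T.map_comp, br_mul, T.map_neg]

lemma br_map_cap (W : C) :
    D.br (T.obj W) ≫ T.map (D.cap W) = T.map (D.ibr W) ≫ D.cap (T.obj W) := by
  rw [← D.map_br_br_cap, ← T.map_comp_assoc, ibr_br, T.map_id, Category.id_comp]

lemma map_br_cap (W : C) :
    T.map (D.br W) ≫ D.cap (T.obj W) = D.ibr (T.obj W) ≫ T.map (D.cap W) := by
  rw [← D.br_map_br_cap, reassoc_of% D.ibr_br]

lemma map_cup_ibr (W : C) :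
    T.map (D.cup W) ≫ D.ibr (T.obj W) = D.cup (T.obj W) ≫ T.map (D.br W) := by
  rw [← D.cup_map_br_br, Category.assoc, Category.assoc, br_ibr, Category.comp_id]

lemma br_map_mul_cap [T.Additive] (W : C) :
    D.br (T.obj W) ≫ T.map (D.mul W) ≫ D.cap W = - (T.map (D.mul W) ≫ D.cap W) := by
  rw [map_mul_cap, reassoc_of% D.br_mul, Preadditive.neg_comp]

lemma g_eq (W : C) : D.g W = T.map (T.map (D.mul W)) ≫ D.mul (T.obj W) ≫ D.cap W := by
  rw [g, reassoc_of% D.mul_nat]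

lemma E_eq (W : C) : D.E W = T.map (T.map (D.cap W)) ≫ D.cap W := by
  rw [E, cap_nat]

lemma s₃_s₂_E (W : C) : D.s₃ W ≫ D.s₂ W ≫ D.E W = D.E' W := by
  rw [E_eq, ← T.map_comp_assoc, ← T.map_comp_assoc, E', Category.assoc, map_br_br_cap]

lemma s₁_s₂_E (W : C) : D.s₁ W ≫ D.s₂ W ≫ D.E W = D.E' W := by
  rw [E, E', reassoc_of% D.br_map_br_cap]

lemma s₃_E (W : C) : D.s₃ W ≫ D.E W = D.E W := by
  rw [E, reassoc_of% D.cap_nat, br_cap]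

lemma s₁_E (W : C) : D.s₁ W ≫ D.E W = D.E W := by
  rw [E, reassoc_of% D.br_cap]

lemma s₁_E' (W : C) : D.s₁ W ≫ D.E' W = D.is₂ W ≫ D.E W := by
  rw [E, E', ← Category.assoc, br_map_cap, Category.assoc]

lemma map_ibr_map_cap (W : C) :
    T.map (D.ibr (T.obj W)) ≫ T.map (T.map (D.cap W)) =
      T.map (T.map (D.br W)) ≫ T.map (D.cap (T.obj W)) := by
  rw [← T.map_comp, ← T.map_comp, map_br_cap]

lemma s₃_E' (W : C) : D.s₃ W ≫ D.E' W = D.is₂ W ≫ D.E W := by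
  rw [E_eq, E', ← Category.assoc, ← Category.assoc, map_ibr_map_cap]

/-- Pulling the first strand across a product vertex leaves a crossing next to the form of three
variables, which is antisymmetric in its first two arguments; this is the source of the sign. -/
lemma s₁_s₂_g [T.Additive] (W : C) : D.s₁ W ≫ D.s₂ W ≫ D.g W = - D.h W := by
  rw [g, h, reassoc_of% D.br_map_br_mul, br_map_mul_cap, Preadditive.comp_neg]

lemma s₃_s₂_g [T.Additive] (W : C) : D.s₃ W ≫ D.s₂ W ≫ D.g W = - D.h W := by
  rw [g_eq, h, ← T.map_comp_assoc, ← T.map_comp_assoc, Category.assoc, map_br_br_mul,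
    ← D.map_mul_cap, T.map_comp_assoc, reassoc_of% D.map_br_mul]
  simp

lemma s₃_g [T.Additive] (W : C) : D.s₃ W ≫ D.g W = - D.g W := by
  rw [g, reassoc_of% D.mul_nat, reassoc_of% D.map_br_mul]
  simp

lemma s₁_s₂_s₃_h (W : C) : D.s₁ W ≫ D.s₂ W ≫ D.s₃ W ≫ D.h W = D.g W := by
  have e := congrArg T.map (D.br_map_br_mul W)
  simp only [T.map_comp] at e
  rw [h, reassoc_of% e, g_eq, map_mul_cap, ← reassoc_of% D.br_nat, reassoc_of% D.br_map_br_mul,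
    br_cap, map_mul_cap]

lemma s₂_s₃_s₂ (W : C) : D.s₂ W ≫ D.s₃ W ≫ D.s₂ W = D.s₃ W ≫ D.s₂ W ≫ D.s₃ W := by
  simp only [s₂, s₃, ← T.map_comp, yang_baxter]

lemma is₃_s₃ (W : C) : D.is₃ W ≫ D.s₃ W = 𝟙 _ := by
  simp only [s₃, is₃, ← T.map_comp, ibr_br, T.map_id]

lemma s₂_is₂ (W : C) : D.s₂ W ≫ D.is₂ W = 𝟙 _ := by
  simp only [s₂, is₂, ← T.map_comp, br_ibr, T.map_id]

lemma s₂_g [T.Additive] (W : C) :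
    D.s₂ W ≫ D.g W = D.h W + (2 : ℕ) • D.E W - D.s₂ W ≫ D.E W - D.E' W := by
  have e := D.norm W
  have e₁ := D.s₃_s₂_g W
  have e₂ := D.s₃_s₂_E W
  simp only [g, E, s₂, s₃] at e e₁ e₂ ⊢
  rw [e₁, e₂] at e
  rw [eq_comm, ← sub_eq_zero] at e ⊢
  rw [← e]
  abel

lemma s₁_h [T.Additive] (W : C) :
    D.s₁ W ≫ D.h W = D.is₂ W ≫ D.E W + D.E' W - (2 : ℕ) • D.E W - D.h W := by
  have e := congrArg (D.s₁ W ≫ ·) (D.s₂_g W)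
  simp only [Preadditive.comp_add, Preadditive.comp_sub, Preadditive.comp_nsmul, s₁_s₂_g,
    s₁_s₂_E, s₁_E, s₁_E'] at e
  rw [← sub_eq_zero] at e ⊢
  rw [← neg_eq_zero, ← e]
  abel

lemma rot_s₂ (W : C) {Z : C} (F : T.obj (T.obj (T.obj (T.obj W))) ⟶ Z) :
    D.s₁ W ≫ D.s₂ W ≫ D.s₃ W ≫ D.s₂ W ≫ F = D.s₁ W ≫ D.s₃ W ≫ D.s₂ W ≫ D.s₃ W ≫ F := by
  rw [reassoc_of% D.s₂_s₃_s₂]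

/-- A second evaluation of the left side of `s₁_h`: the norm identity is rotated through all four
strands, and the braid relation turns the inner crossings into ones that g and E absorb. The two
evaluations together give `g_add_h`. -/
lemma s₁_h' [T.Additive] (W : C) :
    D.s₁ W ≫ D.h W = D.g W + (2 : ℕ) • D.E' W - D.is₂ W ≫ D.E W - D.E W := by
  have e := congrArg (fun F => D.s₁ W ≫ D.s₂ W ≫ D.s₃ W ≫ F) (D.s₂_g W)
  have e' : D.s₂ W ≫ D.is₂ W ≫ D.E W = D.E W := (reassoc_of% D.s₂_is₂ W) _
  simp only [Preadditive.comp_add, Preadditive.comp_sub, Preadditive.comp_nsmul] at e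
  rw [rot_s₂, rot_s₂] at e
  simpa only [s₃_g, s₃_E, s₃_s₂_E, s₃_s₂_g, Preadditive.comp_neg, Preadditive.comp_sub, neg_neg,
    s₁_s₂_s₃_h, s₁_s₂_E, s₃_E', s₁_E, s₁_E', e'] using e

lemma g_add_h [T.Additive] (W : C) :
    D.g W + D.h W = (2 : ℕ) • (D.is₂ W ≫ D.E W) - D.E W - D.E' W := by
  have e := (D.s₁_h' W).symm.trans (D.s₁_h W)
  rw [← sub_eq_zero] at e ⊢
  rw [← e]
  abel

lemma s₁_s₂_s₃_is₂_E (W : C) :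
    D.s₁ W ≫ D.s₂ W ≫ D.s₃ W ≫ D.is₂ W ≫ D.E W = D.s₂ W ≫ D.E W := by
  have e : D.s₂ W ≫ D.s₃ W ≫ D.is₂ W = D.is₃ W ≫ D.s₂ W ≫ D.s₃ W := by
    calc _ = D.is₃ W ≫ (D.s₃ W ≫ D.s₂ W ≫ D.s₃ W) ≫ D.is₂ W := by
            simp only [Category.assoc, reassoc_of% D.is₃_s₃]
      _ = _ := by
            rw [← s₂_s₃_s₂]
            simp only [Category.assoc, s₂_is₂, Category.comp_id]
  have e' : D.s₁ W ≫ D.is₃ W = D.is₃ W ≫ D.s₁ W := (D.br_nat _).symm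
  rw [reassoc_of% e, s₃_E, reassoc_of% e', s₁_s₂_E, ← D.s₃_s₂_E, reassoc_of% D.is₃_s₃]

lemma s₁_s₂_s₃_g [T.Additive] (W : C) : D.s₁ W ≫ D.s₂ W ≫ D.s₃ W ≫ D.g W = D.h W := by
  rw [s₃_g, Preadditive.comp_neg, Preadditive.comp_neg, s₁_s₂_g, neg_neg]

/-- Full rotation by s₁, s₂, s₃ exchanges g with h and E with E', so it preserves every term of
`g_add_h` except the crossed pairing, whose inverse crossing becomes a crossing. Twice the two
crossed pairings therefore agree. -/
lemma s₂_E_eq [T.Additive] (two : ∀ {X Y : C} (f f' : X ⟶ Y), (2 : ℕ) • f = (2 : ℕ) • f' → f = f')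
    (W : C) : D.s₂ W ≫ D.E W = D.is₂ W ≫ D.E W := by
  apply two
  have e := congrArg (fun F => D.s₁ W ≫ D.s₂ W ≫ D.s₃ W ≫ F) (D.g_add_h W)
  have e' : D.s₂ W ≫ D.is₂ W ≫ D.E W = D.E W := (reassoc_of% D.s₂_is₂ W) _
  simp only [Preadditive.comp_add, Preadditive.comp_sub, Preadditive.comp_nsmul,
    s₁_s₂_s₃_g, s₁_s₂_s₃_h, s₁_s₂_s₃_is₂_E, s₃_E, s₃_E', s₁_s₂_E, e', s₁_E] at e
  have e₂ := D.g_add_h W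
  rw [add_comm, e] at e₂
  rw [← sub_eq_zero] at e₂ ⊢
  rw [← e₂]
  abel

/-- Nondegeneracy of E: bending the outer legs back with the snake equations recovers an operator
inserted in the two middle strands. Equal forms thus come from equal operators. -/
lemma bend_E (W : C) (F : ∀ W, T.obj (T.obj W) ⟶ T.obj (T.obj W))
    (hF : ∀ {W W'} (f : W ⟶ W'), T.map (T.map f) ≫ F W' = F W ≫ T.map (T.map f)) :
    T.map (T.map (D.cup W)) ≫ D.cup _ ≫ T.map (T.map (F (T.obj (T.obj W))) ≫ D.E (T.obj W)) =
      F W := by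
  have e := D.cup_nat (F (T.obj (T.obj W)))
  have e' := congrArg T.map (D.map_cup_cap W)
  rw [T.map_id, T.map_comp] at e'
  rw [T.map_comp, ← reassoc_of% e, E, T.map_comp, reassoc_of% D.cup_map_cap,
    reassoc_of% (hF (D.cup W)),
    e', Category.comp_id]

/-- The braiding of a vector product algebra is an involution. -/
lemma ibr_eq [T.Additive] (two : ∀ {X Y : C} (f f' : X ⟶ Y), (2 : ℕ) • f = (2 : ℕ) • f' → f = f')
    (W : C) : D.ibr W = D.br W := by
  rw [← D.bend_E W D.br D.br_nat, ← D.bend_E W D.ibr]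
  · exact congrArg (fun F => _ ≫ _ ≫ T.map F) (D.s₂_E_eq two (T.obj W)).symm
  · intro W W' f
    rw [← cancel_mono (D.br W'), Category.assoc, ibr_br, Category.comp_id, Category.assoc, br_nat,
      reassoc_of% D.ibr_br]

end CrossProduct
end CrossProduct
-- Operators on V ⊗ V and the polynomial relation for the dimension
section CrossProductDim

variable {C : Type u} [Category.{v} C] [Preadditive C]

namespace CrossProduct

variable {T : C ⥤ C} (D : CrossProduct T)

/-- The comultiplication dual to `mul`. -/
def N (W : C) : T.obj W ⟶ T.obj (T.obj W) := T.map (D.cup W) ≫ D.mul (T.obj W)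

/-- The coproduct may be obtained by bending either leg of the product, because a ⬝ (b × c) = (a ×
b) ⬝ c. -/
lemma N_eq (W : C) : D.N W = D.cup (T.obj W) ≫ T.map (D.mul W) := by
  have e := congrArg T.map (D.map_mul_cap (T.obj W))
  have e' := congrArg T.map (D.map_cup_cap W)
  simp only [T.map_comp, T.map_id] at e e'
  calc D.N W = T.map (D.cup W) ≫ D.mul (T.obj W) ≫ D.cup _ ≫ T.map (D.cap _) := by
        rw [cup_map_cap, Category.comp_id, N]
    _ = D.cup (T.obj W) ≫ T.map (T.map (T.map (D.cup W))) ≫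
          T.map (T.map (D.mul (T.obj W))) ≫ T.map (D.cap _) := by
        rw [reassoc_of% D.cup_nat, reassoc_of% D.cup_nat]
    _ = _ := by
        rw [e, ← T.map_comp_assoc, mul_nat, T.map_comp_assoc, e', Category.comp_id]

lemma N_nat {W W' : C} (f : W ⟶ W') : T.map f ≫ D.N W' = D.N W ≫ T.map (T.map f) := by
  rw [N, N, ← T.map_comp_assoc, cup_nat, T.map_comp_assoc, mul_nat, Category.assoc]

lemma N_map_cap (W : C) : D.N (T.obj W) ≫ T.map (D.cap W) = D.mul W := by
  rw [N, Category.assoc, ← mul_nat, ← T.map_comp_assoc, cup_map_cap, T.map_id, Category.id_comp]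

lemma map_N_cap (W : C) : T.map (D.N W) ≫ D.cap (T.obj W) = D.mul W := by
  rw [N, T.map_comp, Category.assoc, map_mul_cap, reassoc_of% D.mul_nat, map_cup_cap,
    Category.comp_id]

/-- A closed loop passes through a strand. This is what makes the dimension behave as a scalar for T
in `map_smul`. -/
lemma map_cup_map_cap (W : C) :
    T.map (D.cup W) ≫ T.map (D.cap W) = D.cup (T.obj W) ≫ D.cap (T.obj W) := by
  rw [← br_map_br_cap, ← cup_map_br_br]
  simp only [Category.assoc]
  rw [br_map_br_cap, map_br_br_cap]

/-- `a ⊗ b ↦ (a ⬝ b) η` -/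
abbrev uOp (W : C) : T.obj (T.obj W) ⟶ T.obj (T.obj W) := D.cap W ≫ D.cup W
/-- The composite of multiplication and comultiplication. -/
abbrev kOp (W : C) : T.obj (T.obj W) ⟶ T.obj (T.obj W) := D.mul W ≫ D.N W
/-- The operator with a horizontal rung. -/
def hOp (W : C) : T.obj (T.obj W) ⟶ T.obj (T.obj W) := T.map (D.N W) ≫ D.mul (T.obj W)

/-- Turn the last two arguments of a form into outputs. -/
abbrev op (W : C) (F : T.obj (T.obj (T.obj (T.obj (T.obj (T.obj W))))) ⟶ T.obj (T.obj W)) :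
    T.obj (T.obj W) ⟶ T.obj (T.obj W) :=
  T.map (T.map (D.cup W)) ≫ T.map (T.map (T.map (D.cup (T.obj W)))) ≫ F

lemma op_g (W : C) : D.op W (D.g _) = D.kOp W := by
  rw [op, g, reassoc_of% D.mul_nat, reassoc_of% D.mul_nat, map_mul_cap, kOp, N, ← T.map_comp_assoc]
  rw [T.map_comp_assoc, reassoc_of% D.mul_nat, map_cup_cap,
    Category.comp_id]

lemma op_h (W : C) : D.op W (D.h _) = D.hOp W := by
  have e := congrArg T.map (D.mul_nat (D.cup (T.obj W)))
  simp only [T.map_comp] at e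
  rw [op, h, reassoc_of% e, map_mul_cap, reassoc_of% D.mul_nat, map_cup_cap,
    Category.comp_id, hOp, N, T.map_comp_assoc]

lemma op_E (W : C) : D.op W (D.E _) = D.uOp W := by
  rw [op, E, reassoc_of% D.cap_nat, map_cup_cap, Category.comp_id, cap_nat]

lemma op_E' (W : C) : D.op W (D.E' _) = 𝟙 _ := by
  have e := congrArg T.map (D.cap_nat (D.cup (T.obj W)))
  have e' := congrArg T.map (D.map_cup_cap W)
  simp only [T.map_comp, T.map_id] at e e'
  rw [op, E', reassoc_of% e, map_cup_cap, Category.comp_id, e']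

lemma cup_br (W : C) : D.cup W ≫ D.br W = D.cup W := by
  calc _ = D.cup W ≫ D.cup _ ≫ T.map (T.map (D.br W)) ≫ T.map (D.cap (T.obj W)) := by
        rw [← reassoc_of% D.cup_nat, cup_map_cap, Category.comp_id]
    _ = D.cup W ≫ T.map (T.map (D.cup W) ≫ D.ibr (T.obj W)) ≫ T.map (T.map (D.cap W)) := by
        rw [← T.map_comp, map_br_cap, T.map_comp, reassoc_of% D.cup_nat, T.map_comp_assoc]
    _ = D.cup W := by
        rw [map_cup_ibr, ← T.map_comp, Category.assoc, ← T.map_comp, br_cap, cup_map_cap, T.map_id,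
          Category.comp_id]

/-- The cup is symmetric and the product antisymmetric, so the composite equals its own negative. -/
lemma cup_mul [T.Additive] (two : ∀ {X Y : C} (f : X ⟶ Y), (2 : ℕ) • f = 0 → f = 0) (W : C) :
    D.cup W ≫ D.mul W = 0 := by
  apply two
  have e : D.cup W ≫ D.mul W = - (D.cup W ≫ D.mul W) := by
    conv_lhs => rw [← cup_br, Category.assoc, br_mul, Preadditive.comp_neg]
  rw [two_nsmul]
  nth_rw 1 [e]
  exact neg_add_cancel _

section

variable (hs : ∀ W, D.ibr W = D.br W)
include hs

lemma br_br (W : C) : D.br W ≫ D.br W = 𝟙 _ := by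
  have := D.br_ibr W
  rwa [hs] at this

lemma map_cup_map_br_cap (W : C) :
    T.map (T.map (D.cup W)) ≫ T.map (D.br (T.obj W)) ≫ D.cap (T.obj (T.obj W)) = D.br W := by
  have e' := congrArg T.map (D.map_cup_cap W)
  simp only [T.map_comp, T.map_id] at e'
  rw [map_br_cap, hs, reassoc_of% D.br_nat, e', Category.comp_id]

lemma op_X (W : C) : D.op W (D.is₂ _ ≫ D.E _) = D.br W := by
  have e := congrArg T.map (D.br_nat (D.cup (T.obj W)))
  simp only [T.map_comp] at e
  rw [op, E, is₂, hs, reassoc_of% e, reassoc_of% D.cap_nat, map_cup_cap, Category.comp_id,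
    map_cup_map_br_cap _ hs]

/-- `g_add_h` with its last two arguments turned into outputs: the five forms become K, H, B, U and
the identity. -/
lemma hOp_eq [T.Additive] (W : C) :
    D.hOp W = (2 : ℕ) • D.br W - D.uOp W - 𝟙 _ - D.kOp W := by
  have e := congrArg (D.op W) (D.g_add_h _)
  simp only [op, Preadditive.comp_add, Preadditive.comp_sub, Preadditive.comp_nsmul] at e
  have e₁ := D.op_g W
  have e₂ := D.op_h W
  have e₃ := D.op_E W
  have e₄ := D.op_E' W
  have e₅ := D.op_X hs W
  simp only [op] at e₁ e₂ e₃ e₄ e₅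
  rw [e₁, e₂, e₃, e₄, e₅] at e
  rw [← sub_eq_zero] at e ⊢
  rw [← e]
  abel

lemma N_br [T.Additive] (W : C) : D.N W ≫ D.br W = - D.N W := by
  rw [N, Category.assoc, ← D.map_br_br_mul, ← T.map_comp_assoc, cup_br, ← hs, ← Category.assoc,
    map_cup_ibr, Category.assoc, map_br_mul, Preadditive.comp_neg, ← N_eq, N]

lemma N_cap [T.Additive] (two : ∀ {X Y : C} (f : X ⟶ Y), (2 : ℕ) • f = 0 → f = 0) (W : C) :
    D.N W ≫ D.cap W = 0 := by
  apply two
  have e : D.N W ≫ D.cap W = - (D.N W ≫ D.cap W) := by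
    conv_lhs => rw [← br_cap, ← Category.assoc, N_br _ hs, Preadditive.neg_comp]
  rw [two_nsmul]
  nth_rw 1 [e]
  exact neg_add_cancel _

end

section Dimension

variable {R : Type*} [CommRing R] [Linear R C] (n : R)
  (hn : ∀ W, D.cup W ≫ D.cap W = n • 𝟙 W)

lemma trace_kOp (W : C) :
    T.map (D.cup W) ≫ D.kOp (T.obj W) ≫ T.map (D.cap W) = D.N W ≫ D.mul W := by
  rw [kOp, Category.assoc, N_map_cap, N, Category.assoc]

lemma trace_hOp [T.Additive] (two : ∀ {X Y : C} (f : X ⟶ Y), (2 : ℕ) • f = 0 → f = 0) (W : C) :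
    T.map (D.cup W) ≫ D.hOp (T.obj W) ≫ T.map (D.cap W) = 0 := by
  rw [hOp, Category.assoc, ← mul_nat, ← T.map_comp_assoc (D.N _), N_map_cap, ← T.map_comp_assoc,
    cup_mul _ two, T.map_zero, Limits.zero_comp]

lemma trace_br (W : C) :
    T.map (D.cup W) ≫ D.br (T.obj W) ≫ T.map (D.cap W) = 𝟙 _ := by
  rw [br_map_cap, ← Category.assoc, ← T.map_comp]
  have : D.cup W ≫ D.ibr W = D.cup W := by
    conv_lhs => rw [← cup_br, Category.assoc, br_ibr, Category.comp_id]
  rw [this, map_cup_cap]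

lemma trace_uOp (W : C) :
    T.map (D.cup W) ≫ D.uOp (T.obj W) ≫ T.map (D.cap W) = 𝟙 _ := by
  rw [uOp, Category.assoc, cup_map_cap, Category.comp_id, map_cup_cap]

include hn in
lemma map_smul (W : C) : T.map (n • 𝟙 W) = n • 𝟙 (T.obj W) := by
  rw [← hn, ← hn, T.map_comp, map_cup_map_cap]

include hn in
lemma map_smul' {W W' : C} (f : W ⟶ W') : T.map (n • f) = n • T.map f := by
  have : n • f = (n • 𝟙 W) ≫ f := by rw [Linear.smul_comp, Category.id_comp]
  rw [this, T.map_comp, D.map_smul n hn, Linear.smul_comp, Category.id_comp]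

variable [T.Additive] (hs : ∀ W, D.ibr W = D.br W)
  (two : ∀ {X Y : C} (f : X ⟶ Y), (2 : ℕ) • f = 0 → f = 0)
include hn hs two

/-- Partial trace of `hOp_eq`: H contributes 0, B and U contribute 1 each, the identity contributes
n, and K contributes the bubble being computed. -/
lemma N_mul (W : C) : D.N W ≫ D.mul W = (1 - n) • 𝟙 _ := by
  have e := congrArg (fun F => T.map (D.cup W) ≫ F ≫ T.map (D.cap W)) (D.hOp_eq hs (T.obj W))
  simp only [Preadditive.comp_sub, Preadditive.sub_comp, Preadditive.comp_nsmul,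
    Preadditive.nsmul_comp, trace_hOp _ two, trace_kOp, trace_uOp, trace_br, Category.id_comp] at e
  rw [← T.map_comp, hn, D.map_smul n hn] at e
  rw [eq_comm, sub_eq_zero] at e
  rw [← e]
  module

/-- The ladder with two rungs. -/
lemma hOp_hOp (W : C) : D.hOp W ≫ D.hOp W =
    5 • 𝟙 _ - 4 • D.br W + n • D.uOp W - 2 • D.uOp W + 7 • D.kOp W - n • D.kOp W := by
  -- The square is expanded with B² = 1, BU = UB = U, BK = KB = -K, U² = nU, UK = KU = 0 and K² = (1
  -- - n)K.
  rw [hOp_eq _ hs]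
  simp only [Preadditive.comp_sub, Preadditive.sub_comp, Category.assoc, Category.comp_id,
    Category.id_comp, br_br _ hs,
    reassoc_of% D.br_cap, cup_br, reassoc_of% D.br_mul, N_br _ hs, reassoc_of% (D.N_cap hs two),
    reassoc_of% (D.cup_mul two), reassoc_of% (D.N_mul n hn hs two), reassoc_of% hn,
    Preadditive.comp_neg, Preadditive.neg_comp, Linear.comp_smul, Linear.smul_comp,
    Limits.comp_zero, Limits.zero_comp]
  module

omit hn hs two in
/-- A quarter turn. -/
abbrev rho (F : ∀ W, T.obj (T.obj W) ⟶ T.obj (T.obj W)) (W : C) :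
    T.obj (T.obj W) ⟶ T.obj (T.obj W) :=
  T.map (T.map (D.cup W)) ≫ T.map (F (T.obj W)) ≫ D.cap _

omit [T.Additive] hn hs two in
lemma rho_kOp (W : C) : D.rho D.kOp W = D.hOp W := by
  rw [rho, kOp, T.map_comp_assoc, map_N_cap, hOp, N, T.map_comp_assoc]

omit [T.Additive] hn hs two in
lemma rho_uOp (W : C) : D.rho D.uOp W = 𝟙 _ := by
  have e := congrArg T.map (D.map_cup_cap W)
  simp only [T.map_comp, T.map_id] at e
  rw [rho, uOp, T.map_comp_assoc, map_cup_cap, Category.comp_id, e]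

omit [T.Additive] hn hs two in
lemma rho_id (W : C) : D.rho (fun _ => 𝟙 _) W = D.uOp W := by
  rw [rho, T.map_id, Category.id_comp, cap_nat]

omit [T.Additive] hn two in
lemma rho_br (W : C) : D.rho D.br W = D.br W := by
  rw [rho, map_cup_map_br_cap _ hs]

omit [T.Additive] hn hs two in
-- Two rungs between two rails form a square with a leg at each corner, which a quarter turn maps to
-- itself.
lemma rho_hOp_hOp (W : C) : D.rho (fun W => D.hOp W ≫ D.hOp W) W = D.hOp W ≫ D.hOp W := by
  -- Fusing a strand with the first leg of a newly created trivalent vertex amounts to splitting the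
  -- strand and then splitting its right branch.
  have e : T.map (D.cup W ≫ D.N (T.obj W)) ≫ D.mul _ = D.N W ≫ T.map (D.N W) := by
    rw [N_eq, T.map_comp, T.map_comp, Category.assoc, Category.assoc, mul_nat]
    rw [← Category.assoc (T.map (D.cup _)) (D.mul _), ← N, reassoc_of% D.N_nat, ← T.map_comp, ← N]
  have e' := congrArg T.map e
  simp only [T.map_comp] at e'
  calc D.rho (fun W => D.hOp W ≫ D.hOp W) W
      = T.map (T.map (D.cup W)) ≫ T.map (T.map (D.N (T.obj W))) ≫ T.map (D.mul _) ≫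
          T.map (T.map (D.N (T.obj W))) ≫ T.map (D.mul _) ≫ D.cap _ := by
        simp only [rho, hOp, T.map_comp, Category.assoc]
    _ = T.map (T.map (D.cup W)) ≫ T.map (T.map (D.N (T.obj W))) ≫ T.map (D.mul _) ≫
          D.mul _ ≫ D.mul _ := by
        rw [map_mul_cap, reassoc_of% D.mul_nat, map_N_cap]
    _ = D.hOp W ≫ D.hOp W := by
        rw [reassoc_of% e', hOp, Category.assoc, ← reassoc_of% D.mul_nat]

/-- The expansion of H² and that of its quarter turn differ by (7 - n)(1 - U + K - H); eliminating H
makes this 2(7 - n)(1 + K - B), and the factor 2 cancels. -/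
lemma sub_nsmul_eq_zero (W : C) : (7 - n) • (𝟙 _ + D.kOp W - D.br W) = 0 := by
  apply two
  have e := D.hOp_hOp n hn hs two W
  have e' : D.rho (fun W => D.hOp W ≫ D.hOp W) W =
      5 • D.uOp W - 4 • D.br W + n • 𝟙 _ - 2 • 𝟙 _ + 7 • D.hOp W - n • D.hOp W := by
    conv_rhs => rw [← D.rho_id, ← D.rho_uOp, ← D.rho_kOp, ← D.rho_br hs]
    simp only [rho, D.hOp_hOp n hn hs two, T.map_add, T.map_sub, T.map_nsmul,
      D.map_smul' n hn, Preadditive.comp_add, Preadditive.comp_sub, Preadditive.add_comp,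
      Preadditive.sub_comp, Linear.comp_smul, Linear.smul_comp]
  rw [rho_hOp_hOp, e] at e'
  rw [hOp_eq _ hs, ← sub_eq_zero] at e'
  refine Eq.trans ?_ e'
  module

theorem dim_smul_eq_zero (W : C) : (n * (n - 1) * (n - 3) * (n - 7)) • 𝟙 W = 0 := by
  -- Between coproduct and product, 1, K and -B give 1 - n, (1 - n)² and 1 - n, with sum (1 - n)(3 -
  -- n); the closing loop supplies the factor n.
  have e := congrArg (fun F => D.cup W ≫ (D.N _ ≫ F ≫ D.mul _) ≫ D.cap W)
    (D.sub_nsmul_eq_zero n hn hs two (T.obj W))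
  simp only [Preadditive.comp_add, Preadditive.comp_sub, Preadditive.add_comp,
    Preadditive.sub_comp, Linear.comp_smul, Linear.smul_comp, kOp, br_mul, Preadditive.comp_neg,
    Preadditive.neg_comp, D.N_mul n hn hs two, reassoc_of% (D.N_mul n hn hs two), hn,
    Category.id_comp, Category.assoc, Limits.comp_zero, Limits.zero_comp] at e
  rw [← neg_eq_zero]
  refine Eq.trans ?_ e
  module

end Dimension

end CrossProduct
end CrossProductDim
-- Structure morphisms acting on the leftmost tensor factors
section Whiskered

variable {C : Type u} [Category.{v} C] [MonoidalCategory C]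

/-- A morphism `X ⊗ Y ⟶ Z` acting on the two leftmost factors. -/
def act₂₁ {X Y Z : C} (f : X ⊗ Y ⟶ Z) (W : C) : X ⊗ (Y ⊗ W) ⟶ Z ⊗ W :=
  (α_ X Y W).inv ≫ f ▷ W

def act₂₂ {X Y Z Z' : C} (f : X ⊗ Y ⟶ Z ⊗ Z') (W : C) : X ⊗ (Y ⊗ W) ⟶ Z ⊗ (Z' ⊗ W) :=
  (α_ X Y W).inv ≫ f ▷ W ≫ (α_ Z Z' W).hom

def act₂₀ {X Y : C} (f : X ⊗ Y ⟶ 𝟙_ C) (W : C) : X ⊗ (Y ⊗ W) ⟶ W :=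
  (α_ X Y W).inv ≫ f ▷ W ≫ (λ_ W).hom

def act₀₂ {X Y : C} (f : 𝟙_ C ⟶ X ⊗ Y) (W : C) : W ⟶ X ⊗ (Y ⊗ W) :=
  (λ_ W).inv ≫ f ▷ W ≫ (α_ X Y W).hom

def act₀₁ {X : C} (f : 𝟙_ C ⟶ X) (W : C) : W ⟶ X ⊗ W :=
  (λ_ W).inv ≫ f ▷ W

lemma act₂₁_nat {X Y Z : C} (φ : X ⊗ Y ⟶ Z) {W W' : C} (f : W ⟶ W') :
    X ◁ (Y ◁ f) ≫ act₂₁ φ W' = act₂₁ φ W ≫ Z ◁ f := by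
  rw [act₂₁, act₂₁, associator_inv_naturality_right_assoc, whisker_exchange, Category.assoc]

lemma act₂₂_nat {X Y Z Z' : C} (φ : X ⊗ Y ⟶ Z ⊗ Z') {W W' : C} (f : W ⟶ W') :
    X ◁ (Y ◁ f) ≫ act₂₂ φ W' = act₂₂ φ W ≫ Z ◁ (Z' ◁ f) := by
  rw [act₂₂, act₂₂, associator_inv_naturality_right_assoc, whisker_exchange_assoc,
    associator_naturality_right]
  simp only [Category.assoc]

lemma act₂₀_nat {X Y : C} (φ : X ⊗ Y ⟶ 𝟙_ C) {W W' : C} (f : W ⟶ W') :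
    X ◁ (Y ◁ f) ≫ act₂₀ φ W' = act₂₀ φ W ≫ f := by
  rw [act₂₀, act₂₀, associator_inv_naturality_right_assoc, whisker_exchange_assoc,
    leftUnitor_naturality]
  simp only [Category.assoc]

lemma act₀₂_nat {X Y : C} (φ : 𝟙_ C ⟶ X ⊗ Y) {W W' : C} (f : W ⟶ W') :
    f ≫ act₀₂ φ W' = act₀₂ φ W ≫ X ◁ (Y ◁ f) := by
  rw [act₀₂, act₀₂, leftUnitor_inv_naturality_assoc, whisker_exchange_assoc,
    associator_naturality_right]
  simp only [Category.assoc]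

lemma act₀₁_nat {X : C} (φ : 𝟙_ C ⟶ X) {W W' : C} (f : W ⟶ W') :
    f ≫ act₀₁ φ W' = act₀₁ φ W ≫ X ◁ f := by
  rw [act₀₁, act₀₁, leftUnitor_inv_naturality_assoc, whisker_exchange, Category.assoc]

lemma act₂₀_eq {X Y : C} (f : X ⊗ Y ⟶ 𝟙_ C) (W : C) :
    act₂₀ f W = act₂₁ f W ≫ (λ_ W).hom := by
  simp [act₂₀, act₂₁]

lemma act₀₂_eq {X Y : C} (f : 𝟙_ C ⟶ X ⊗ Y) (W : C) :
    act₀₂ f W = act₀₁ f W ≫ (α_ X Y W).hom := by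
  simp [act₀₂, act₀₁]

variable [BraidedCategory C]

/-- The braiding of the two leftmost factors. -/
def brd (X Y W : C) : X ⊗ (Y ⊗ W) ⟶ Y ⊗ (X ⊗ W) := act₂₂ (β_ X Y).hom W

def ibrd (X Y W : C) : X ⊗ (Y ⊗ W) ⟶ Y ⊗ (X ⊗ W) := act₂₂ (β_ Y X).inv W

lemma brd_ibrd (X Y W : C) : brd X Y W ≫ ibrd Y X W = 𝟙 _ := by
  simp [brd, ibrd, act₂₂, ← comp_whiskerRight_assoc]

lemma ibrd_brd (X Y W : C) : ibrd X Y W ≫ brd Y X W = 𝟙 _ := by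
  simp [brd, ibrd, act₂₂, ← comp_whiskerRight_assoc]

lemma brd_brd_right (X Y Z W : C) :
    brd X Y (Z ⊗ W) ≫ Y ◁ brd X Z W =
      X ◁ (α_ Y Z W).inv ≫ brd X (Y ⊗ Z) W ≫ (α_ Y Z (X ⊗ W)).hom := by
  simp only [brd, act₂₂, BraidedCategory.braiding_tensor_right_hom]
  monoidal

lemma brd_brd_left (X Y Z W : C) :
    X ◁ brd Y Z W ≫ brd X Z (Y ⊗ W) =
      (α_ X Y (Z ⊗ W)).inv ≫ brd (X ⊗ Y) Z W ≫ Z ◁ (α_ X Y W).hom := by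
  simp only [brd, act₂₂, BraidedCategory.braiding_tensor_left_hom]
  monoidal

lemma brd_nat_left {X X' : C} (f : X ⟶ X') (Y W : C) :
    f ▷ (Y ⊗ W) ≫ brd X' Y W = brd X Y W ≫ Y ◁ (f ▷ W) := by
  simp only [brd, act₂₂]
  have := congrArg (· ▷ W) (BraidedCategory.braiding_naturality_left f Y)
  simp only [comp_whiskerRight] at this
  simp only [associator_inv_naturality_left_assoc, reassoc_of% this, Category.assoc]
  simp

lemma brd_nat_right {Y Y' : C} (X : C) (f : Y ⟶ Y') (W : C) :
    X ◁ (f ▷ W) ≫ brd X Y' W = brd X Y W ≫ f ▷ (X ⊗ W) := by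
  simp only [brd, act₂₂]
  have := congrArg (· ▷ W) (BraidedCategory.braiding_naturality_right X f)
  simp only [comp_whiskerRight] at this
  simp only [associator_inv_naturality_middle_assoc, reassoc_of% this, Category.assoc]
  simp

lemma brd_unit_right (X W : C) :
    brd X (𝟙_ C) W = X ◁ (λ_ W).hom ≫ (λ_ _).inv := by
  simp only [brd, act₂₂, braiding_tensorUnit_right]
  monoidal

lemma brd_unit_left (X W : C) :
    brd (𝟙_ C) X W = (λ_ _).hom ≫ X ◁ (λ_ W).inv := by
  simp only [brd, act₂₂, braiding_tensorUnit_left]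
  monoidal

lemma brd_brd_act₂₁ {X Y Z Z' : C} (f : Y ⊗ Z ⟶ Z') (W : C) :
    brd X Y (Z ⊗ W) ≫ Y ◁ brd X Z W ≫ act₂₁ f (X ⊗ W) = X ◁ act₂₁ f W ≫ brd X Z' W := by
  have e := brd_nat_right X f W
  simp only [act₂₁, MonoidalCategory.whiskerLeft_comp, Category.assoc, e]
  rw [reassoc_of% brd_brd_right X Y Z W]
  simp

lemma brd_brd_act₂₁' {X Y Z Z' : C} (f : X ⊗ Y ⟶ Z') (W : C) :
    X ◁ brd Y Z W ≫ brd X Z (Y ⊗ W) ≫ Z ◁ act₂₁ f W = act₂₁ f (Z ⊗ W) ≫ brd Z' Z W := by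
  have e := brd_nat_left f Z W
  simp only [act₂₁, MonoidalCategory.whiskerLeft_comp, Category.assoc, e]
  rw [reassoc_of% brd_brd_left X Y Z W]
  simp

lemma brd_brd_act₂₀ {X Y Z : C} (f : Y ⊗ Z ⟶ 𝟙_ C) (W : C) :
    brd X Y (Z ⊗ W) ≫ Y ◁ brd X Z W ≫ act₂₀ f (X ⊗ W) = X ◁ act₂₀ f W := by
  rw [act₂₀_eq, act₂₀_eq, ← Category.assoc, ← Category.assoc, Category.assoc (brd X Y _),
    brd_brd_act₂₁, brd_unit_right]
  simp

lemma brd_brd_act₂₀' {X Y Z : C} (f : X ⊗ Y ⟶ 𝟙_ C) (W : C) :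
    X ◁ brd Y Z W ≫ brd X Z (Y ⊗ W) ≫ Z ◁ act₂₀ f W = act₂₀ f (Z ⊗ W) := by
  rw [act₂₀_eq, act₂₀_eq, MonoidalCategory.whiskerLeft_comp, ← Category.assoc, ← Category.assoc,
    Category.assoc (X ◁ brd _ _ _), brd_brd_act₂₁', brd_unit_left]
  simp

lemma act₀₁_brd {X Y : C} (f : 𝟙_ C ⟶ X) (W : C) :
    act₀₁ f (Y ⊗ W) ≫ brd X Y W = Y ◁ act₀₁ f W := by
  rw [act₀₁, Category.assoc, brd_nat_left, brd_unit_left, act₀₁]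
  simp

lemma map_act₀₁_brd {X Y : C} (f : 𝟙_ C ⟶ Y) (W : C) :
    X ◁ act₀₁ f W ≫ brd X Y W = act₀₁ f (X ⊗ W) := by
  rw [act₀₁, MonoidalCategory.whiskerLeft_comp, Category.assoc, brd_nat_right, brd_unit_right,
    act₀₁]
  simp

lemma act₀₂_brd_brd {X Y Z : C} (f : 𝟙_ C ⟶ X ⊗ Y) (W : C) :
    act₀₂ f (Z ⊗ W) ≫ X ◁ brd Y Z W ≫ brd X Z (Y ⊗ W) = Z ◁ act₀₂ f W := by
  rw [brd_brd_left, act₀₂_eq, act₀₂_eq]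
  simp [reassoc_of% act₀₁_brd f W]

/-- By the hexagon, two successive crossings over Z are one crossing of the tensor product X ⊗ Y
over Z; naturality slides the braiding of X and Y through it. -/
lemma brd_yang_baxter (X Y Z W : C) :
    brd X Y (Z ⊗ W) ≫ Y ◁ brd X Z W ≫ brd Y Z (X ⊗ W) =
      X ◁ brd Y Z W ≫ brd X Z (Y ⊗ W) ≫ Z ◁ brd X Y W := by
  have e := congrArg (· ≫ Z ◁ brd X Y W) (brd_brd_left X Y Z W)
  have e' := congrArg (Z ◁ ·) ((Iso.cancel_iso_hom_left (α_ X Y W) _ _).2 (brd.eq_1 X Y W))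
  simp only [Category.assoc, act₂₂, MonoidalCategory.whiskerLeft_comp, Iso.hom_inv_id_assoc]
    at e e'
  rw [e, e', ← reassoc_of% brd_nat_left, brd_brd_left, brd, act₂₂]
  simp

lemma brd_act₂₀ {X Y : C} (f : Y ⊗ X ⟶ 𝟙_ C) (W : C) :
    brd X Y W ≫ act₂₀ f W = act₂₀ ((β_ X Y).hom ≫ f) W := by
  simp [brd, act₂₂, act₂₀]

lemma brd_nat (X Y : C) {W W' : C} (f : W ⟶ W') :
    X ◁ (Y ◁ f) ≫ brd X Y W' = brd X Y W ≫ Y ◁ (X ◁ f) := act₂₂_nat _ f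

end Whiskered

/-! ### Composition algebras in whiskered form -/

section Algebra

variable {C : Type u} [Category.{v} C] [MonoidalCategory C] [BraidedCategory C] [Preadditive C]

namespace CompositionAlgebra

variable {A : C} (S : CompositionAlgebra A)

def ev : A ⊗ A ⟶ 𝟙_ C := letI := S.dual; ε_ A A

def coev : 𝟙_ C ⟶ A ⊗ A := letI := S.dual; η_ A A

abbrev capA (W : C) : A ⊗ (A ⊗ W) ⟶ W := act₂₀ S.ev W
abbrev cupA (W : C) : W ⟶ A ⊗ (A ⊗ W) := act₀₂ S.coev W
abbrev mulA (W : C) : A ⊗ (A ⊗ W) ⟶ A ⊗ W := act₂₁ S.m W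
abbrev eA (W : C) : W ⟶ A ⊗ W := act₀₁ S.e W

/-- The linear form `e ⬝ -`. -/
def tr : A ⟶ 𝟙_ C := (λ_ A).inv ≫ S.e ▷ A ≫ S.ev

def trA (W : C) : A ⊗ W ⟶ W := S.tr ▷ W ≫ (λ_ W).hom

lemma br_cap (W : C) : brd A A W ≫ S.capA W = S.capA W := by
  rw [brd_act₂₀]
  exact congrArg (act₂₀ · W) S.symm

lemma cup_map_cap (W : C) : S.cupA (A ⊗ W) ≫ A ◁ S.capA W = 𝟙 _ := by
  let := S.dual
  have e := ExactPairing.evaluation_coevaluation A A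
  have e' := congrArg (fun f => (λ_ (A ⊗ W)).inv ≫ (α_ _ _ _).inv ≫ f ▷ W ≫ (ρ_ A).hom ▷ W) e
  refine Eq.trans ?_ (e'.trans ?_)
  · simp only [cupA, capA, act₀₂, act₂₀, ev, coev]
    monoidal
  · monoidal

lemma map_cup_cap (W : C) : A ◁ S.cupA W ≫ S.capA (A ⊗ W) = 𝟙 _ := by
  let := S.dual
  have e := ExactPairing.coevaluation_evaluation A A
  have e' := congrArg (fun f => A ◁ (λ_ W).inv ≫ (α_ _ _ _).inv ≫ f ▷ W ≫ (λ_ A).hom ▷ W) e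
  refine Eq.trans ?_ (e'.trans ?_)
  · simp only [cupA, capA, act₀₂, act₂₀, ev, coev]
    monoidal
  · monoidal

lemma e_mul (W : C) : S.eA (A ⊗ W) ≫ S.mulA W = 𝟙 _ := by
  have e := congrArg (· ▷ W) S.e_m
  refine Eq.trans ?_ (e.trans ?_)
  · simp only [eA, mulA, act₀₁, act₂₁]
    monoidal
  · simp

lemma map_e_mul (W : C) : A ◁ S.eA W ≫ S.mulA W = 𝟙 _ := by
  have e := congrArg (· ▷ W) S.m_e
  refine Eq.trans ?_ (e.trans ?_)
  · simp only [eA, mulA, act₀₁, act₂₁]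
    monoidal
  · simp

lemma e_cap (W : C) : S.eA (A ⊗ W) ≫ S.capA W = S.trA W := by
  simp only [eA, capA, trA, tr, act₀₁, act₂₀]
  monoidal

lemma map_e_cap (W : C) : A ◁ S.eA W ≫ S.capA W = S.trA W := by
  rw [← S.br_cap, reassoc_of% map_act₀₁_brd S.e W, e_cap]

lemma e_tr : S.e ≫ S.tr = 𝟙 _ := by
  rw [← S.norm_e, tr, leftUnitor_inv_naturality_assoc, whisker_exchange_assoc, tensorHom_def_assoc,
    ev]

lemma eA_trA (W : C) : S.eA W ≫ S.trA W = 𝟙 _ := by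
  rw [trA, eA, act₀₁, Category.assoc, ← comp_whiskerRight_assoc, e_tr]
  simp

/-- `(a b) ⬝ (c d)` -/
def f (W : C) : A ⊗ (A ⊗ (A ⊗ (A ⊗ W))) ⟶ W :=
  S.mulA (A ⊗ (A ⊗ W)) ≫ A ◁ S.mulA W ≫ S.capA W

lemma norm [MonoidalPreadditive C] (W : C) :
    A ◁ brd A A (A ⊗ W) ≫ S.f W + A ◁ (A ◁ brd A A W) ≫ A ◁ brd A A (A ⊗ W) ≫ S.f W =
      (2 : ℕ) • (S.capA (A ⊗ (A ⊗ W)) ≫ S.capA W) := by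
  have e := congrArg (fun f => A ◁ A ◁ (α_ A A W).inv ≫ (α_ A A ((A ⊗ A) ⊗ W)).inv ≫
    (α_ (A ⊗ A) (A ⊗ A) W).inv ≫ f ▷ W ≫ (λ_ W).hom) S.norm_m
  simp only [MonoidalPreadditive.add_whiskerRight, Preadditive.comp_add, Preadditive.add_comp] at e
  have e₂ := congrArg (A ◁ ·) (brd_brd_left A A A W)
  simp only [MonoidalCategory.whiskerLeft_comp] at e₂
  rw [reassoc_of% e₂]
  refine Eq.trans ?_ (e.trans ?_)
  · congr 1
    · simp only [brd, f, mulA, capA, act₂₂, act₂₁, act₂₀, ev, MonoidalCategory.tensorHom_def]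
      monoidal
    · simp only [brd, f, mulA, capA, act₂₂, act₂₁, act₂₀, ev, MonoidalCategory.tensorHom_def]
      monoidal
  · simp only [two_nsmul, MonoidalPreadditive.add_whiskerRight, Preadditive.comp_add,
      Preadditive.add_comp, capA, act₂₀, ev, MonoidalCategory.tensorHom_def]
    congr 1 <;> monoidal

end CompositionAlgebra
end Algebra

/-! ### The imaginary part as a vector product algebra -/

section Imaginary

variable {C : Type u} [Category.{v} C] [MonoidalCategory C] 

/-- The inclusion of `V ⊗ V` into `A ⊗ A` given by `i : V ⟶ A`. -/
def J {V A : C} (i : V ⟶ A) (W : C) : V ⊗ (V ⊗ W) ⟶ A ⊗ (A ⊗ W) :=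
  i ▷ (V ⊗ W) ≫ A ◁ (i ▷ W)

lemma J_nat {V A : C} (i : V ⟶ A) {W W' : C} (g : W ⟶ W') :
    V ◁ V ◁ g ≫ J i W' = J i W ≫ A ◁ A ◁ g := by
  rw [J, whisker_exchange_assoc, ← MonoidalCategory.whiskerLeft_comp, whisker_exchange,
    MonoidalCategory.whiskerLeft_comp, J, Category.assoc]

/-- The inclusion of `V ⊗ V ⊗ V` into `A ⊗ A ⊗ A`. -/
def J₃ {V A : C} (i : V ⟶ A) (W : C) : V ⊗ (V ⊗ (V ⊗ W)) ⟶ A ⊗ (A ⊗ (A ⊗ W)) :=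
  J i (V ⊗ W) ≫ A ◁ (A ◁ (i ▷ W))

lemma J₃_eq {V A : C} (i : V ⟶ A) (W : C) : J₃ i W = i ▷ (V ⊗ (V ⊗ W)) ≫ A ◁ J i W := by
  simp only [J, J₃, Category.assoc, MonoidalCategory.whiskerLeft_comp]

/-- The inclusion of `V ⊗ V ⊗ V ⊗ V` into `A ⊗ A ⊗ A ⊗ A`. -/
def J₄ {V A : C} (i : V ⟶ A) (W : C) :
    V ⊗ (V ⊗ (V ⊗ (V ⊗ W))) ⟶ A ⊗ (A ⊗ (A ⊗ (A ⊗ W))) :=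
  J i (V ⊗ (V ⊗ W)) ≫ A ◁ (A ◁ J i W)

lemma J₄_eq {V A : C} (i : V ⟶ A) (W : C) : J₄ i W = i ▷ _ ≫ A ◁ J₃ i W := by
  simp only [J, J₃, J₄, Category.assoc, MonoidalCategory.whiskerLeft_comp]

variable [BraidedCategory C]

lemma J_br {V A : C} (i : V ⟶ A) (W : C) : brd V V W ≫ J i W = J i W ≫ brd A A W := by
  simp only [J, Category.assoc, brd_nat_right, reassoc_of% brd_nat_left, whisker_exchange]

lemma J₃_br {V A : C} (i : V ⟶ A) (W : C) :
    brd V V (V ⊗ W) ≫ J₃ i W = J₃ i W ≫ brd A A (A ⊗ W) := by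
  rw [J₃, reassoc_of% J_br, ← brd_nat, Category.assoc]

lemma map_br_J₄ {V A : C} (i : V ⟶ A) (W : C) :
    V ◁ brd V V (V ⊗ W) ≫ J₄ i W = J₄ i W ≫ A ◁ brd A A (A ⊗ W) := by
  rw [J₄_eq, whisker_exchange_assoc, ← MonoidalCategory.whiskerLeft_comp, J₃_br,
    MonoidalCategory.whiskerLeft_comp, Category.assoc]

lemma map_map_br_J₄ {V A : C} (i : V ⟶ A) (W : C) :
    V ◁ V ◁ brd V V W ≫ J₄ i W = J₄ i W ≫ A ◁ A ◁ brd A A W := by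
  rw [J₄, reassoc_of% J_nat, ← MonoidalCategory.whiskerLeft_comp,
    ← MonoidalCategory.whiskerLeft_comp, J_br]
  simp only [MonoidalCategory.whiskerLeft_comp, Category.assoc]

variable [Preadditive C]

namespace CompositionAlgebra

variable {A : C} (S : CompositionAlgebra A)

lemma e_f (W : C) : S.eA _ ≫ S.f W = A ◁ S.mulA W ≫ S.capA W := by
  rw [f, reassoc_of% S.e_mul]

lemma map_e_f (W : C) : A ◁ S.eA _ ≫ S.f W = A ◁ S.mulA W ≫ S.capA W := by
  rw [f, reassoc_of% S.map_e_mul]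

lemma map_map_e_f (W : C) : A ◁ A ◁ S.eA _ ≫ S.f W = S.mulA _ ≫ S.capA W := by
  rw [f, reassoc_of% act₂₁_nat, ← MonoidalCategory.whiskerLeft_comp_assoc, e_mul]
  simp

lemma map_map_map_e_f (W : C) : A ◁ A ◁ A ◁ S.eA _ ≫ S.f W = S.mulA _ ≫ S.capA W := by
  rw [f, reassoc_of% act₂₁_nat, ← MonoidalCategory.whiskerLeft_comp_assoc, map_e_mul]
  simp

variable {V : C} (i : V ⟶ A) (r : A ⟶ V)

lemma J_mul (W : C) :
    act₂₁ ((i ⊗ₘ i) ≫ S.m ≫ r) W = J i W ≫ S.mulA W ≫ r ▷ W := by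
  simp only [J, mulA, act₂₁, MonoidalCategory.tensorHom_def]
  monoidal

lemma J_cap (W : C) : act₂₀ ((i ⊗ₘ i) ≫ S.ev) W = J i W ≫ S.capA W := by
  simp only [J, capA, act₂₀, MonoidalCategory.tensorHom_def]
  monoidal

lemma cup_r (W : C) :
    act₀₂ (S.coev ≫ (r ⊗ₘ r)) W = S.cupA W ≫ r ▷ (A ⊗ W) ≫ V ◁ (r ▷ W) := by
  simp only [cupA, act₀₂, MonoidalCategory.tensorHom_def]
  monoidal

lemma trA_nat {W W' : C} (g : W ⟶ W') : A ◁ g ≫ S.trA W' = S.trA W ≫ g := by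
  rw [trA, trA, whisker_exchange_assoc, leftUnitor_naturality, Category.assoc]

variable [MonoidalPreadditive C]

/-- The norm identity with e in its first slot; `norm_e₂` and `norm_e₃` use the third and the second
slot. On imaginary arguments all three right-hand sides vanish. -/
lemma norm_e₁ (W : C) :
    brd A A (A ⊗ W) ≫ A ◁ S.mulA W ≫ S.capA W + S.mulA (A ⊗ W) ≫ S.capA W =
      (2 : ℕ) • (S.trA (A ⊗ (A ⊗ W)) ≫ S.capA W) := by
  have e := congrArg (S.eA _ ≫ ·) (S.norm W)
  simp only [Preadditive.comp_add, Preadditive.comp_nsmul] at e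
  have e₁ := act₀₁_nat S.e (brd A A (A ⊗ W))
  have e₂ := act₀₁_nat S.e (A ◁ brd A A W)
  rwa [← reassoc_of% e₁, ← reassoc_of% e₂, ← reassoc_of% e₁, e_f, reassoc_of% S.e_cap,
    reassoc_of% brd_brd_act₂₁' S.m, br_cap] at e

lemma norm_e₂ (W : C) :
    A ◁ S.mulA W ≫ S.capA W + A ◁ brd A A W ≫ S.mulA (A ⊗ W) ≫ S.capA W =
      (2 : ℕ) • (S.capA (A ⊗ W) ≫ S.trA W) := by
  have e := congrArg (A ◁ A ◁ S.eA (A ⊗ W) ≫ ·) (S.norm W)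
  have e₁ : A ◁ A ◁ S.eA (A ⊗ W) ≫ A ◁ brd A A (A ⊗ W) = A ◁ S.eA _ := by
    rw [← MonoidalCategory.whiskerLeft_comp, map_act₀₁_brd]
  have e₂ : A ◁ A ◁ S.eA (A ⊗ W) ≫ A ◁ A ◁ brd A A W = A ◁ A ◁ A ◁ S.eA W := by
    rw [← MonoidalCategory.whiskerLeft_comp, ← MonoidalCategory.whiskerLeft_comp, act₀₁_brd]
  have e₃ : A ◁ A ◁ A ◁ S.eA W ≫ A ◁ brd A A (A ⊗ W) = A ◁ brd A A W ≫ A ◁ A ◁ A ◁ S.eA W := by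
    rw [← MonoidalCategory.whiskerLeft_comp, ← MonoidalCategory.whiskerLeft_comp, brd_nat]
  simpa only [Preadditive.comp_add, Preadditive.comp_nsmul, reassoc_of% e₁, reassoc_of% e₂,
    reassoc_of% e₃, map_e_f, map_map_map_e_f, reassoc_of% act₂₀_nat S.ev (S.eA (A ⊗ W)), e_cap]
    using e

lemma norm_e₃ (W : C) :
    S.mulA (A ⊗ W) ≫ S.capA W + A ◁ brd A A W ≫ S.mulA (A ⊗ W) ≫ S.capA W =
      (2 : ℕ) • (S.trA (A ⊗ (A ⊗ W)) ≫ S.capA W) := by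
  have e := congrArg (A ◁ S.eA (A ⊗ (A ⊗ W)) ≫ ·) (S.norm W)
  have e₁ : A ◁ S.eA (A ⊗ (A ⊗ W)) ≫ A ◁ brd A A (A ⊗ W) = A ◁ A ◁ S.eA _ := by
    rw [← MonoidalCategory.whiskerLeft_comp, act₀₁_brd]
  have e₂ : A ◁ S.eA (A ⊗ (A ⊗ W)) ≫ A ◁ A ◁ brd A A W = A ◁ brd A A W ≫ A ◁ S.eA _ := by
    rw [← MonoidalCategory.whiskerLeft_comp, ← MonoidalCategory.whiskerLeft_comp, eA, ← act₀₁_nat]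
  simpa only [Preadditive.comp_add, Preadditive.comp_nsmul, reassoc_of% e₁, reassoc_of% e₂,
    map_map_e_f, reassoc_of% S.map_e_cap] using e

/-- `norm_e₂` with its first argument set to e. On V it says that the real part of ab is -(a ⬝ b).
-/
lemma mul_tr (W : C) :
    S.mulA W ≫ S.trA W = (2 : ℕ) • (S.trA (A ⊗ W) ≫ S.trA W) - S.capA W := by
  have e := congrArg (S.eA _ ≫ ·) (S.norm_e₂ W)
  have e₁ := act₀₁_nat S.e (S.mulA W)
  have e₂ := act₀₁_nat S.e (brd A A W)
  simp only [Preadditive.comp_add, Preadditive.comp_nsmul, ← reassoc_of% e₁, e_cap,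
    ← reassoc_of% e₂, reassoc_of% S.e_mul, reassoc_of% S.e_cap, S.br_cap] at e
  exact eq_sub_of_add_eq e

section

variable (hir : i ≫ r = 𝟙 V) (hri : r ≫ i = 𝟙 A - S.tr ≫ S.e)
include hir hri

omit [MonoidalPreadditive C] in
lemma i_tr : i ≫ S.tr = 0 := by
  have e : i = i - i ≫ S.tr ≫ S.e := by
    conv_lhs => rw [← Category.id_comp i, ← hir, Category.assoc, hri, Preadditive.comp_sub,
      Category.comp_id]
  have e' : i ≫ S.tr ≫ S.e = 0 := by rwa [eq_comm, sub_eq_self] at e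
  rw [← Category.comp_id (i ≫ S.tr), ← S.e_tr, ← Category.assoc, Category.assoc i, e',
    Limits.zero_comp]

lemma i_trA (W : C) : i ▷ W ≫ S.trA W = 0 := by
  rw [trA, ← comp_whiskerRight_assoc, S.i_tr i r hir hri]
  simp

omit hir in
lemma p_whisker (W : C) : (r ≫ i) ▷ W = 𝟙 _ - S.trA W ≫ S.eA W := by
  have e : (r ≫ i) ▷ W + (S.tr ≫ S.e) ▷ W = 𝟙 _ := by
    rw [← MonoidalPreadditive.add_whiskerRight, hri, sub_add_cancel, id_whiskerRight]
  rw [eq_sub_iff_add_eq, ← e, trA, eA, act₀₁]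
  simp

lemma p_cap (W : C) :
    (r ≫ i) ▷ (V ⊗ W) ≫ A ◁ (i ▷ W) ≫ S.capA W = A ◁ (i ▷ W) ≫ S.capA W := by
  rw [S.p_whisker i r hri, Preadditive.sub_comp, Category.id_comp, sub_eq_self, Category.assoc,
    ← reassoc_of% act₀₁_nat S.e (i ▷ W), e_cap, S.i_trA i r hir hri, Limits.comp_zero]

omit hir in
lemma map_p_cap (W : C) :
    A ◁ ((r ≫ i) ▷ W) ≫ S.capA W = S.capA W - S.trA (A ⊗ W) ≫ S.trA W := by
  have e : A ◁ (𝟙 (A ⊗ W) - S.trA W ≫ S.eA W) = A ◁ 𝟙 _ - A ◁ (S.trA W ≫ S.eA W) :=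
    (tensorLeft A).map_sub
  rw [S.p_whisker i r hri, e, Preadditive.sub_comp, MonoidalCategory.whiskerLeft_id,
    Category.id_comp, MonoidalCategory.whiskerLeft_comp, Category.assoc, map_e_cap, trA_nat]

lemma cap_p (W : C) :
    i ▷ (A ⊗ W) ≫ A ◁ ((r ≫ i) ▷ W) ≫ S.capA W = i ▷ (A ⊗ W) ≫ S.capA W := by
  rw [S.map_p_cap i r hri, Preadditive.comp_sub, reassoc_of% S.i_trA i r hir hri,
    Limits.zero_comp, sub_zero]

omit hir in
lemma p_p_cap (W : C) :
    (r ≫ i) ▷ (A ⊗ W) ≫ A ◁ ((r ≫ i) ▷ W) ≫ S.capA W =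
      S.capA W - S.trA (A ⊗ W) ≫ S.trA W := by
  rw [S.map_p_cap i r hri, S.p_whisker i r hri]
  simp only [Preadditive.sub_comp, Preadditive.comp_sub, Category.id_comp, Category.assoc,
    S.e_cap, reassoc_of% S.eA_trA]
  abel

lemma cupV_map_capV (W : C) :
    act₀₂ (S.coev ≫ (r ⊗ₘ r)) (V ⊗ W) ≫ V ◁ act₂₀ ((i ⊗ₘ i) ≫ S.ev) W = 𝟙 _ := by
  have e := congrArg (V ◁ ·) (S.p_cap i r hir hri W)
  simp only [MonoidalCategory.whiskerLeft_comp, comp_whiskerRight, Category.assoc] at e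
  rw [cup_r, J_cap, J]
  simp only [MonoidalCategory.whiskerLeft_comp, Category.assoc]
  rw [e, ← MonoidalCategory.whiskerLeft_comp, ← whisker_exchange,
    MonoidalCategory.whiskerLeft_comp, Category.assoc,
    ← reassoc_of% act₀₂_nat S.coev (i ▷ W), reassoc_of% S.cup_map_cap, ← comp_whiskerRight, hir,
    id_whiskerRight]

lemma map_cupV_capV (W : C) :
    V ◁ act₀₂ (S.coev ≫ (r ⊗ₘ r)) W ≫ act₂₀ ((i ⊗ₘ i) ≫ S.ev) (V ⊗ W) = 𝟙 _ := by
  have e := S.cap_p i r hir hri (A ⊗ W)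
  simp only [MonoidalCategory.whiskerLeft_comp, comp_whiskerRight] at e
  rw [cup_r, J_cap, J]
  simp only [MonoidalCategory.whiskerLeft_comp, Category.assoc, whisker_exchange_assoc] at e ⊢
  rw [← MonoidalCategory.whiskerLeft_comp_assoc A (V ◁ _), whisker_exchange,
    MonoidalCategory.whiskerLeft_comp_assoc, act₂₀_nat, ← whisker_exchange_assoc, reassoc_of% e,
    whisker_exchange_assoc, reassoc_of% S.map_cup_cap, ← comp_whiskerRight, hir, id_whiskerRight]

lemma J₃_tr (W : C) : J₃ i W ≫ S.trA _ = 0 := by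
  rw [J₃_eq, Category.assoc, trA_nat, reassoc_of% S.i_trA i r hir hri, Limits.zero_comp]

lemma J₃_cap_tr (W : C) : J₃ i W ≫ S.capA _ ≫ S.trA _ = 0 := by
  rw [J₃, Category.assoc, reassoc_of% act₂₀_nat S.ev, S.i_trA i r hir hri, Limits.comp_zero,
    Limits.comp_zero]

/-- Projecting the product to V changes nothing once it is paired with a vector of V, since V is
orthogonal to e. -/
lemma map_mulV_capV (W : C) :
    V ◁ act₂₁ ((i ⊗ₘ i) ≫ S.m ≫ r) W ≫ act₂₀ ((i ⊗ₘ i) ≫ S.ev) W =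
      J₃ i W ≫ A ◁ S.mulA W ≫ S.capA W := by
  have e := S.map_p_cap i r hri W
  simp only [MonoidalCategory.whiskerLeft_comp, comp_whiskerRight, Category.assoc] at e
  rw [J_mul, J_cap, J₃_eq, J]
  simp only [MonoidalCategory.whiskerLeft_comp, Category.assoc, whisker_exchange_assoc]
  rw [e]
  simp only [Preadditive.comp_sub, reassoc_of% S.trA_nat, reassoc_of% S.i_trA i r hir hri,
    Limits.zero_comp, sub_zero]

lemma mulV_capV (W : C) :
    act₂₁ ((i ⊗ₘ i) ≫ S.m ≫ r) (V ⊗ W) ≫ act₂₀ ((i ⊗ₘ i) ≫ S.ev) W =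
      J₃ i W ≫ S.mulA _ ≫ S.capA W := by
  have e := S.p_cap i r hir hri W
  simp only [comp_whiskerRight, Category.assoc] at e
  rw [J_mul, J_cap, J₃, J.eq_1 i W]
  simp only [Category.assoc]
  rw [e, ← reassoc_of% act₂₁_nat S.m]

/-- On V, `norm_e₂` and `norm_e₃` say that a ⬝ bc and ab ⬝ c are both cancelled by the same third
term. -/
lemma map_mulV_capV_eq (W : C) :
    V ◁ act₂₁ ((i ⊗ₘ i) ≫ S.m ≫ r) W ≫ act₂₀ ((i ⊗ₘ i) ≫ S.ev) W =
      act₂₁ ((i ⊗ₘ i) ≫ S.m ≫ r) (V ⊗ W) ≫ act₂₀ ((i ⊗ₘ i) ≫ S.ev) W := by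
  have e₂ := congrArg (J₃ i W ≫ ·) (S.norm_e₂ W)
  have e₃ := congrArg (J₃ i W ≫ ·) (S.norm_e₃ W)
  simp only [Preadditive.comp_add, Preadditive.comp_nsmul, S.J₃_cap_tr i r hir hri,
    reassoc_of% S.J₃_tr i r hir hri, Limits.zero_comp, nsmul_zero] at e₂ e₃
  rw [S.map_mulV_capV i r hir hri, S.mulV_capV i r hir hri]
  exact add_right_cancel (e₂.trans e₃.symm)

/-- `norm_e₁` on V makes the form (a × b) ⬝ c antisymmetric in a and b, given `map_mulV_capV_eq`;
duality then removes the pairing with c. -/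
lemma br_mulV (W : C) :
    brd V V W ≫ act₂₁ ((i ⊗ₘ i) ≫ S.m ≫ r) W = - act₂₁ ((i ⊗ₘ i) ≫ S.m ≫ r) W := by
  have unbend : act₂₁ ((i ⊗ₘ i) ≫ S.m ≫ r) W =
      V ◁ V ◁ act₀₂ (S.coev ≫ (r ⊗ₘ r)) W ≫ act₂₁ ((i ⊗ₘ i) ≫ S.m ≫ r) _ ≫
        act₂₀ ((i ⊗ₘ i) ≫ S.ev) (V ⊗ W) := by
    rw [reassoc_of% act₂₁_nat, S.map_cupV_capV i r hir hri, Category.comp_id]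
  have e : brd V V (V ⊗ (V ⊗ W)) ≫ act₂₁ ((i ⊗ₘ i) ≫ S.m ≫ r) _ ≫
        act₂₀ ((i ⊗ₘ i) ≫ S.ev) (V ⊗ W) =
      - (act₂₁ ((i ⊗ₘ i) ≫ S.m ≫ r) _ ≫ act₂₀ ((i ⊗ₘ i) ≫ S.ev) (V ⊗ W)) := by
    rw [← S.map_mulV_capV_eq i r hir hri, S.map_mulV_capV i r hir hri, reassoc_of% J₃_br,
      eq_neg_iff_add_eq_zero]
    have e₁ := congrArg (J₃ i (V ⊗ W) ≫ ·) (S.norm_e₁ (V ⊗ W))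
    simp only [Preadditive.comp_add, Preadditive.comp_nsmul,
      reassoc_of% S.J₃_tr i r hir hri, Limits.zero_comp, nsmul_zero] at e₁
    rw [← e₁, ← S.mulV_capV i r hir hri, ← S.map_mulV_capV_eq i r hir hri,
      S.map_mulV_capV i r hir hri]
  rw [unbend, ← reassoc_of% brd_nat, e, Preadditive.comp_neg]

omit [MonoidalPreadditive C] hir hri in
lemma capV_capV (W : C) :
    act₂₀ ((i ⊗ₘ i) ≫ S.ev) _ ≫ act₂₀ ((i ⊗ₘ i) ≫ S.ev) W =
      J₄ i W ≫ S.capA _ ≫ S.capA W := by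
  rw [J_cap, J_cap, J₄, Category.assoc, Category.assoc, reassoc_of% act₂₀_nat S.ev (J i W)]

lemma J_mul_tr (W : C) : J i W ≫ S.mulA W ≫ S.trA W = - (J i W ≫ S.capA W) := by
  have e : J i W ≫ S.trA _ = 0 := by
    rw [J, Category.assoc, trA_nat, reassoc_of% S.i_trA i r hir hri, Limits.zero_comp]
  rw [mul_tr, Preadditive.comp_sub, Preadditive.comp_nsmul, reassoc_of% e, Limits.zero_comp,
    nsmul_zero, zero_sub]

/-- On V, ab = a × b - (a ⬝ b) e, so (ab) ⬝ (cd) exceeds (a × b) ⬝ (c × d) by (a ⬝ b)(c ⬝ d). -/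
lemma gV_eq (W : C) :
    act₂₁ ((i ⊗ₘ i) ≫ S.m ≫ r) _ ≫ V ◁ act₂₁ ((i ⊗ₘ i) ≫ S.m ≫ r) W ≫
        act₂₀ ((i ⊗ₘ i) ≫ S.ev) W = J₄ i W ≫ (S.f W - S.capA _ ≫ S.capA W) := by
  have e := S.p_whisker i r hri (V ⊗ (V ⊗ W))
  rw [comp_whiskerRight] at e
  have e₁ := act₀₁_nat S.e (J i W)
  have e₂ := act₀₁_nat S.e (S.mulA W)
  rw [S.map_mulV_capV i r hir hri, J₃_eq, J_mul]
  simp only [Category.assoc]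
  rw [reassoc_of% e]
  simp only [Preadditive.sub_comp, Preadditive.comp_sub, Category.id_comp, Category.assoc,
    ← S.capV_capV, ← reassoc_of% e₁, ← reassoc_of% e₂, e_cap, S.J_mul_tr i r hir hri,
    Preadditive.comp_neg]
  have e₃ := S.J_mul_tr i r hir hri (V ⊗ (V ⊗ W))
  rw [reassoc_of% e₃, J_cap, J_cap, J₄, f, Category.assoc, reassoc_of% act₂₁_nat S.m]
  simp

lemma normV (W : C) :
    V ◁ brd V V (V ⊗ W) ≫ act₂₁ ((i ⊗ₘ i) ≫ S.m ≫ r) _ ≫ V ◁ act₂₁ ((i ⊗ₘ i) ≫ S.m ≫ r) W ≫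
        act₂₀ ((i ⊗ₘ i) ≫ S.ev) W
      + V ◁ V ◁ brd V V W ≫ V ◁ brd V V (V ⊗ W) ≫ act₂₁ ((i ⊗ₘ i) ≫ S.m ≫ r) _ ≫
        V ◁ act₂₁ ((i ⊗ₘ i) ≫ S.m ≫ r) W ≫ act₂₀ ((i ⊗ₘ i) ≫ S.ev) W
      = (2 : ℕ) • (act₂₀ ((i ⊗ₘ i) ≫ S.ev) _ ≫ act₂₀ ((i ⊗ₘ i) ≫ S.ev) W)
        - V ◁ brd V V (V ⊗ W) ≫ act₂₀ ((i ⊗ₘ i) ≫ S.ev) _ ≫ act₂₀ ((i ⊗ₘ i) ≫ S.ev) W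
        - V ◁ V ◁ brd V V W ≫ V ◁ brd V V (V ⊗ W) ≫ act₂₀ ((i ⊗ₘ i) ≫ S.ev) _ ≫
            act₂₀ ((i ⊗ₘ i) ≫ S.ev) W := by
  have e := congrArg (J₄ i W ≫ ·) (S.norm W)
  simp only [Preadditive.comp_add, Preadditive.comp_nsmul] at e
  rw [S.gV_eq i r hir hri, S.capV_capV]
  simp only [reassoc_of% map_br_J₄, reassoc_of% map_map_br_J₄, Preadditive.comp_sub]
  rw [← e]
  abel

omit hir in
-- The pairing restricted to V is the pairing of A minus the product of the two traces; closed up,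
-- that correction is tr(e) = 1.
lemma cupV_capV (W : C) :
    act₀₂ (S.coev ≫ (r ⊗ₘ r)) W ≫ act₂₀ ((i ⊗ₘ i) ≫ S.ev) W = S.cupA W ≫ S.capA W - 𝟙 W := by
  have e := S.p_p_cap i r hri W
  simp only [comp_whiskerRight, MonoidalCategory.whiskerLeft_comp, Category.assoc] at e
  have e₁ : S.cupA W ≫ S.trA (A ⊗ W) = S.eA W := by
    rw [← e_cap, reassoc_of% act₀₁_nat S.e (S.cupA W), map_cup_cap, Category.comp_id]
  rw [cup_r, J_cap, J]
  simp only [Category.assoc]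
  rw [whisker_exchange_assoc, e, Preadditive.comp_sub, reassoc_of% e₁, eA_trA]

end

end CompositionAlgebra
end Imaginary
-- From the vector product algebra back to the composition algebra
section Main

variable {C : Type u} [Category.{v} C] [MonoidalCategory C] [BraidedCategory C] [Preadditive C]

namespace CompositionAlgebra

variable {A : C} (S : CompositionAlgebra A)

/-- The vector product algebra on the orthogonal complement `V` of the identity. -/
def crossProduct [MonoidalPreadditive C] {V : C} (i : V ⟶ A) (r : A ⟶ V) (hir : i ≫ r = 𝟙 V)
    (hri : r ≫ i = 𝟙 A - S.tr ≫ S.e) : CrossProduct (tensorLeft V) where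
  br W := brd V V W
  ibr W := ibrd V V W
  cap W := act₂₀ ((i ⊗ₘ i) ≫ S.ev) W
  cup W := act₀₂ (S.coev ≫ (r ⊗ₘ r)) W
  mul W := act₂₁ ((i ⊗ₘ i) ≫ S.m ≫ r) W
  br_ibr := brd_ibrd V V
  ibr_br := ibrd_brd V V
  br_nat := brd_nat V V
  cap_nat := act₂₀_nat _
  cup_nat := act₀₂_nat _
  mul_nat := act₂₁_nat _
  br_cap W := by
    have e := S.J_cap i W
    simp only [e]
    exact (Category.assoc _ _ _).symm.trans ((congrArg (· ≫ S.capA W) (J_br i W)).trans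
      ((Category.assoc _ _ _).trans (congrArg (J i W ≫ ·) (S.br_cap W))))
  cup_map_cap := S.cupV_map_capV i r hir hri
  map_cup_cap := S.map_cupV_capV i r hir hri
  br_mul := S.br_mulV i r hir hri
  map_mul_cap := S.map_mulV_capV_eq i r hir hri
  yang_baxter := brd_yang_baxter V V V
  br_map_br_cap := brd_brd_act₂₀ _
  map_br_br_cap := brd_brd_act₂₀' _
  cup_map_br_br := act₀₂_brd_brd _
  br_map_br_mul := brd_brd_act₂₁ _
  map_br_br_mul := brd_brd_act₂₁' _
  norm := S.normV i r hir hri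

lemma dim_eq : S.dim = S.coev ≫ S.ev := by
  rw [dim, dimension, coev, ev, S.symm]

lemma cupA_capA_unit : S.cupA (𝟙_ C) ≫ S.capA (𝟙_ C) = S.dim := by
  rw [dim_eq, cupA, capA, act₀₂, act₂₀]
  monoidal

end CompositionAlgebra

end Main

/-- Evaluation of elements of the center at an object. -/
def evalCenter {C : Type u} [Category.{v} C] [Preadditive C] (X : C) : CatCenter C →+* End X where
  toFun z := z.app X
  map_one' := rfl
  map_mul' _ _ := rfl
  map_zero' := rfl
  map_add' _ _ := rfl

/-- The dimension of a vector product algebra, as an element of the center. -/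
def CrossProduct.dim {C : Type u} [Category.{v} C] [Preadditive C] {T : C ⥤ C}
    (D : CrossProduct T) : CatCenter C where
  app W := D.cup W ≫ D.cap W
  naturality W W' g := by
    simp [reassoc_of% D.cup_nat, D.cap_nat]

theorem CrossProduct.dim_relation {C : Type u} [Category.{v} C] [Preadditive C] {T : C ⥤ C}
    [T.Additive] (D : CrossProduct T)
    (two : ∀ X Y : C, Function.Injective (fun f : X ⟶ Y => (2 : ℕ) • f)) :
    D.dim * (D.dim - 1) * (D.dim - 3) * (D.dim - 7) = 0 := by
  -- The loop is natural in W, so it lies in the center; letting ℤ[X] act with X as the loop makes n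
  -- one scalar for all objects.
  let φ : Polynomial ℤ →+* CatCenter C := (Polynomial.aeval D.dim).toRingHom
  let : Linear (Polynomial ℤ) C := Linear.ofRingMorphism φ
  have hX : φ Polynomial.X = D.dim := Polynomial.aeval_X _
  have hs : ∀ (p : Polynomial ℤ) (W : C), p • 𝟙 W = (φ p).app W := fun p W =>
    (Linear.smulOfRingMorphism_smul_eq φ p (𝟙 W)).trans (Category.comp_id _)
  have h := D.dim_smul_eq_zero (Polynomial.X : Polynomial ℤ) (fun W => by rw [hs, hX]; rfl)
    (D.ibr_eq fun f f' h => two _ _ h) (fun f h => two _ _ (h.trans (smul_zero _).symm))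
  ext W
  have hW := h W
  rw [hs] at hW
  simp only [map_mul, map_sub, map_one, map_ofNat, hX] at hW
  exact hW

end BraidedComposition

theorem mainTheorem4 {C : Type u} [Category.{v} C] [MonoidalCategory C] [BraidedCategory C]
    [Preadditive C] [MonoidalPreadditive C] [IsIdempotentComplete C]
    (two_invertible : ∀ X Y : C, Function.Bijective (fun f : X ⟶ Y => (2 : ℕ) • f))
    (A : C) (S : BraidedComposition.CompositionAlgebra A) :
    (S.dim - 1) * (S.dim - 2) * (S.dim - 4) * (S.dim - 8) = (0 : End (𝟙_ C)) := by
  have hp : (𝟙 A - S.tr ≫ S.e) ≫ (𝟙 A - S.tr ≫ S.e) = 𝟙 A - S.tr ≫ S.e := by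
    simp [reassoc_of% S.e_tr]
  obtain ⟨V, i, r, hir, hri⟩ := IsIdempotentComplete.idempotents_split A _ hp
  let D := S.crossProduct i r hir hri
  have h := D.dim_relation fun X Y => (two_invertible X Y).1
  have hD : BraidedComposition.evalCenter (𝟙_ C) D.dim = S.dim - 1 := by
    rw [← S.cupA_capA_unit]
    exact S.cupV_capV i r hri _
  have h' := congrArg (BraidedComposition.evalCenter (𝟙_ C)) h
  simp only [map_mul, map_sub, map_one, map_ofNat, map_zero, hD, sub_sub] at h'
  -- Substituting n = d_A - 1 shifts the roots 0, 1, 3, 7 to 1, 2, 4, 8.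
  norm_num at h'
  exact h'
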